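/- Let $k$ be an algebraically closed field and let $S$ be an algebraic semigroup over $k$, that is, an algebraic variety over $k$ (a reduced, separated scheme of finite type over $k$, not necessarily irreducible) equipped with an associative morphism $S\times S\to S$; by points of $S$ we mean $k$-rational points, so that these form an abstract semigroup. For an idempotent $e$ of $S$, let $H_e$ denote the group of units of the monoid $eSe$ (with neutral element $e$). Then for every $x\in S$ there is a unique idempotent $e(x)\in S$ such that $x^m\in H_{e(x)}$ for some $m>0$. Moreover, there exists an integer $n>0$, depending only on $S$, such that $x^n\in H_{e(x)}$ for all $x\in S$. Finally, $S$ is the union of finitely many pairwise disjoint locally closed subsets $U_j$ such that, each $U_j$ being equipped with its reduced subscheme structure, the restriction of the map $e:x\mapsto e(x)$ to each $U_j$ is a morphism $U_j\to S$ over $k$. -/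

import Mathlib

open CategoryTheory MonoidalCategory CartesianMonoidalCategory AlgebraicGeometry

universe u v w

/-- A semigroup object in a cartesian monoidal category: an object `S` with an associative
multiplication `S ⊗ S ⟶ S` (no unit is required). -/
class SemigroupObj {C : Type w} [Category.{v} C] [CartesianMonoidalCategory C] (S : C) where
  /-- The multiplication morphism. -/
  mul : S ⊗ S ⟶ S
  mul_assoc : (mul ▷ S) ≫ mul = (α_ S S S).hom ≫ (S ◁ mul) ≫ mul

namespace SemigroupObj

/-- The set of `T`-points of a semigroup object is a semigroup under pointwise multiplication. -/
instance homSemigroup {C : Type w} [Category.{v} C] [CartesianMonoidalCategory C] (T S : C)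
    [SemigroupObj S] : Semigroup (T ⟶ S) where
  mul x y := lift x y ≫ mul
  mul_assoc x y z := by
    change lift (lift x y ≫ mul) z ≫ mul = lift x (lift y z ≫ mul) ≫ mul
    have h := congrArg (fun f => lift (lift x y) z ≫ f) (mul_assoc (S := S))
    simpa using h

end SemigroupObj

/-- The power `x ^ n`, `n > 0`, of an element of a semigroup. -/
def semigroupPow {M : Type w} [Semigroup M] (x : M) (n : ℕ+) : M :=
  PNat.recOn n x (fun _ y => y * x)

/-- For an idempotent `e`, the unit group `H_e` of the monoid `e M e` (with neutral element `e`),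
as a subset of the semigroup `M`. -/
def cornerUnits {M : Type w} [Semigroup M] (e : M) : Set M :=
  {a | a ∈ Subsemigroup.corner e ∧ ∃ b ∈ Subsemigroup.corner e, a * b = e ∧ b * a = e}

/-- `e` is an idempotent such that some positive power of `x` is a unit of `e M e`. -/
def IsAttachedIdempotent {M : Type w} [Semigroup M] (x e : M) : Prop :=
  IsIdempotentElem e ∧ ∃ n : ℕ+, semigroupPow x n ∈ cornerUnits e

section Varieties

variable {k : Type u} [Field k]

/-- The set `S(k)` of `k`-rational points of a `k`-scheme `S`, i.e. the set of `k`-morphisms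
`Spec k ⟶ S`. -/
abbrev RatPoints (S : Over (Spec (.of k))) : Type u :=
  𝟙_ (Over (Spec (.of k))) ⟶ S

/-- The restriction to the locally closed subset `U` of the map `f : S(k) → S'(k)` is a morphism:
if `i : V ⟶ S` is `U` with its reduced induced subscheme structure, then there is a `k`-morphism
`g : V ⟶ S'` which agrees with `f` on `k`-rational points. -/
def IsMorphismOn {S S' : Over (Spec (.of k))} (U : Set S.left) (f : RatPoints S → RatPoints S') :
    Prop :=
  ∃ (V : Over (Spec (.of k))) (i : V ⟶ S) (g : V ⟶ S'),
    IsReduced V.left ∧ IsImmersion i.left ∧ Set.range i.left = U ∧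
      ∀ p : RatPoints V, p ≫ g = f (p ≫ i)

end Varieties

/-! Over an algebraically closed field, the closures of the sets `{x ^ n | n ≥ m}` stabilize for
large `m`, and their elements commute with `x`. Then the shearing map `(a, b) ↦ (a, a * b)` is
dominant on the closure of the set of pairs `(x ^ a, x ^ b)` with `a, b ≥ m`, so by Chevalley's
theorem its image contains such a pair with `a > b`: one gets `x ^ b = x ^ a * z` with `z` in the
stable closure. It follows that some power `p` of `x` has a group inverse `y`, which means that
`p * y = y * p`, `p * y * p = p` and `y * p * y = y`.

Group inverses are unique. Hence they descend along faithfully flat morphisms, and so exist for a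
power of every point with values in a field, in particular for the generic point of an integral
closed subscheme of `S`. Being defined by equations, they spread out to a nonempty open subset of
this subscheme. By Noetherian induction, `S` is a finite disjoint union of reduced subschemes on
which `x ↦ x ^ n` has a group inverse `y` which is a morphism, with the same `n` for all of them.
The idempotent attached to `x` is `x ^ n * y x`. -/

section Semigroup

variable {M : Type w} [Semigroup M]

lemma semigroupPow_one (x : M) : semigroupPow x 1 = x := rfl

lemma semigroupPow_succ (x : M) (n : ℕ+) : semigroupPow x (n + 1) = semigroupPow x n * x :=
  PNat.recOn_succ _ _ _

lemma coe_semigroupPow (x : M) (n : ℕ+) :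
    ((semigroupPow x n : M) : WithOne M) = (x : WithOne M) ^ (n : ℕ) := by
  induction n with
  | one => rw [semigroupPow_one, PNat.one_coe, pow_one]
  | succ n ih => rw [semigroupPow_succ, WithOne.coe_mul, ih, PNat.add_coe, PNat.one_coe, pow_succ]

lemma semigroupPow_add (x : M) (m n : ℕ+) :
    semigroupPow x (m + n) = semigroupPow x m * semigroupPow x n := by
  apply WithOne.coe_injective
  rw [WithOne.coe_mul, coe_semigroupPow, coe_semigroupPow, coe_semigroupPow, PNat.add_coe, pow_add]

lemma semigroupPow_mul (x : M) (m n : ℕ+) :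
    semigroupPow x (m * n) = semigroupPow (semigroupPow x m) n := by
  apply WithOne.coe_injective
  rw [coe_semigroupPow, coe_semigroupPow, coe_semigroupPow, PNat.mul_coe, pow_mul]

lemma commute_semigroupPow_right {x y : M} (h : Commute x y) (n : ℕ+) :
    Commute x (semigroupPow y n) := by
  induction n with
  | one => exact h
  | succ n ih => rw [semigroupPow_succ]; exact ih.mul_right h

lemma commute_semigroupPow_semigroupPow {x y : M} (h : Commute x y) (m n : ℕ+) :
    Commute (semigroupPow x m) (semigroupPow y n) :=
  commute_semigroupPow_right (commute_semigroupPow_right h.symm m).symm n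

lemma mul_semigroupPow {x y : M} (h : Commute x y) (n : ℕ+) :
    semigroupPow (x * y) n = semigroupPow x n * semigroupPow y n := by
  have h' : Commute (x : WithOne M) y := h.map WithOne.coeMulHom
  apply WithOne.coe_injective
  rw [WithOne.coe_mul, coe_semigroupPow, coe_semigroupPow, coe_semigroupPow, WithOne.coe_mul,
    h'.mul_pow]

lemma semigroupPow_of_isIdempotentElem {e : M} (h : IsIdempotentElem e) (n : ℕ+) :
    semigroupPow e n = e := by
  induction n with
  | one => rfl
  | succ n ih => rw [semigroupPow_succ, ih, h.eq]

lemma semigroupPow_mul_eq_self {x e : M} (h : x * e = x) (n : ℕ+) :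
    semigroupPow x n * e = semigroupPow x n := by
  cases n using PNat.recOn with
  | one => exact h
  | succ n => rw [semigroupPow_succ, mul_assoc, h]

lemma map_semigroupPow {N : Type*} [Semigroup N] (φ : M →ₙ* N) (x : M) (n : ℕ+) :
    φ (semigroupPow x n) = semigroupPow (φ x) n := by
  induction n with
  | one => rfl
  | succ n ih => rw [semigroupPow_succ, semigroupPow_succ, map_mul, ih]

/-- `y` is the group inverse of `p`: the two elements are inverse to each other in the unit group
`H_e` of some corner of the semigroup, necessarily the one at the idempotent `e = p * y`. Being
equational, this notion is preserved by homomorphisms and reflected by injective ones. -/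
structure IsGroupInverse (p y : M) : Prop where
  comm : p * y = y * p
  mul_mul_left : p * y * p = p
  mul_mul_right : y * p * y = y

namespace IsGroupInverse

variable {p y z : M}

lemma isIdempotentElem (h : IsGroupInverse p y) : IsIdempotentElem (p * y) := by
  rw [IsIdempotentElem, ← mul_assoc, h.mul_mul_left]

lemma mem_cornerUnits (h : IsGroupInverse p y) : p ∈ cornerUnits (p * y) := by
  refine ⟨?_, y, ?_, rfl, h.comm.symm⟩ <;> rw [Subsemigroup.mem_corner_iff h.isIdempotentElem]
  · exact ⟨h.mul_mul_left, by rw [h.comm, ← mul_assoc, h.mul_mul_left]⟩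
  · exact ⟨by rw [h.comm, h.mul_mul_right], by rw [← mul_assoc, h.mul_mul_right]⟩

lemma exists_of_mem_cornerUnits {e : M} (he : IsIdempotentElem e) (hp : p ∈ cornerUnits e) :
    ∃ y, IsGroupInverse p y ∧ p * y = e := by
  obtain ⟨hp, y, hy, hpy, hyp⟩ := hp
  rw [Subsemigroup.mem_corner_iff he] at hp hy
  exact ⟨y, ⟨hpy.trans hyp.symm, by rw [hpy, hp.1], by rw [hyp, hy.1]⟩, hpy⟩

protected lemma unique (h : IsGroupInverse p y) (h' : IsGroupInverse p z) : y = z := by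
  have idempotents_eq : p * y = p * z := by
    calc p * y = p * z * (p * y) := by rw [← mul_assoc, h'.mul_mul_left]
      _ = z * (p * y * p) := by rw [h'.comm, h.comm, mul_assoc, ← mul_assoc p, ← h.comm]
      _ = p * z := by rw [h.mul_mul_left, h'.comm]
  calc y = y * p * y := h.mul_mul_right.symm
    _ = y * (p * z) := by rw [mul_assoc, idempotents_eq]
    _ = z * p * z := by rw [← mul_assoc, ← h.comm, idempotents_eq, h'.comm]
    _ = z := h'.mul_mul_right

lemma semigroupPow_of_commute {q : M} (h : Commute q z) (hz : z * (q * z) = z) {n : ℕ+}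
    (hq : semigroupPow q n * (q * z) = semigroupPow q n) :
    IsGroupInverse (semigroupPow q n) (semigroupPow z n) := by
  have isIdempotentElem : IsIdempotentElem (q * z) := by rw [IsIdempotentElem, mul_assoc, hz]
  have pow_mul_pow : semigroupPow q n * semigroupPow z n = q * z := by
    rw [← mul_semigroupPow h, semigroupPow_of_isIdempotentElem isIdempotentElem]
  have comm := commute_semigroupPow_semigroupPow h n n
  refine ⟨comm, ?_, ?_⟩
  · rw [mul_assoc, ← comm.eq, pow_mul_pow, hq]
  · rw [mul_assoc, pow_mul_pow, semigroupPow_mul_eq_self hz]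

protected lemma semigroupPow (h : IsGroupInverse p y) (n : ℕ+) :
    IsGroupInverse (semigroupPow p n) (semigroupPow y n) :=
  semigroupPow_of_commute h.comm (by rw [← mul_assoc, h.mul_mul_right])
    (semigroupPow_mul_eq_self (by rw [h.comm, ← mul_assoc, h.mul_mul_left]) n)

lemma semigroupPow_mul_semigroupPow (h : IsGroupInverse p y) (n : ℕ+) :
    _root_.semigroupPow p n * _root_.semigroupPow y n = p * y := by
  rw [← mul_semigroupPow h.comm, semigroupPow_of_isIdempotentElem h.isIdempotentElem]

lemma map {N : Type*} [Semigroup N] (φ : M →ₙ* N) (h : IsGroupInverse p y) :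
    IsGroupInverse (φ p) (φ y) :=
  ⟨by rw [← map_mul, h.comm, map_mul], by rw [← map_mul, ← map_mul, h.mul_mul_left],
    by rw [← map_mul, ← map_mul, h.mul_mul_right]⟩

lemma of_map {N : Type*} [Semigroup N] {φ : M →ₙ* N} (hφ : Function.Injective φ)
    (h : IsGroupInverse (φ p) (φ y)) : IsGroupInverse p y :=
  ⟨hφ (by rw [map_mul, h.comm, map_mul]), hφ (by rw [map_mul, map_mul, h.mul_mul_left]),
    hφ (by rw [map_mul, map_mul, h.mul_mul_right])⟩

lemma isAttachedIdempotent {x : M} {n : ℕ+} (h : IsGroupInverse (_root_.semigroupPow x n) y) :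
    IsAttachedIdempotent x (_root_.semigroupPow x n * y) :=
  ⟨h.isIdempotentElem, n, h.mem_cornerUnits⟩

end IsGroupInverse

lemma IsAttachedIdempotent.unique {x e f : M} (he : IsAttachedIdempotent x e)
    (hf : IsAttachedIdempotent x f) : e = f := by
  obtain ⟨he, m, hm⟩ := he
  obtain ⟨hf, n, hn⟩ := hf
  obtain ⟨y, hy, rfl⟩ := IsGroupInverse.exists_of_mem_cornerUnits he hm
  obtain ⟨z, hz, rfl⟩ := IsGroupInverse.exists_of_mem_cornerUnits hf hn
  have hyn := hy.semigroupPow n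
  have hzm := hz.semigroupPow m
  rw [← hy.semigroupPow_mul_semigroupPow n, ← hz.semigroupPow_mul_semigroupPow m]
  rw [← semigroupPow_mul] at hyn hzm ⊢
  rw [← semigroupPow_mul, mul_comm n m]
  rw [mul_comm n m] at hzm
  rw [hyn.unique hzm]

end Semigroup

section Topology

open TopologicalSpace Topology Set

lemma interior_frontier_preimage_eq_empty {X Y : Type*} [TopologicalSpace X] [TopologicalSpace Y]
    {f : X → Y} (hf : Continuous f) {s : Set Y} (hs : IsConstructible s) :
    interior (frontier (f ⁻¹' s)) = ∅ := by
  induction hs using IsConstructible.empty_union_induction with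
  | open_retrocompact U hU _ =>
    rw [← frontier_compl, interior_frontier (hU.preimage hf).isClosed_compl]
  | union s _ t _ hs ht =>
    refine subset_empty_iff.mp ?_
    calc interior (frontier (f ⁻¹' (s ∪ t)))
        ⊆ interior (frontier (f ⁻¹' s) ∪ frontier (f ⁻¹' t)) := interior_mono <|
          (frontier_union_subset _ _).trans
            (union_subset_union inter_subset_left inter_subset_right)
      _ = ∅ := by rw [interior_union_isClosed_of_interior_empty isClosed_frontier ht, hs]
  | compl s _ hs => rwa [preimage_compl, frontier_compl]

/- In the subspace `closure E`, both sets are dense, and the interior of `E` remains dense because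
the frontier of a constructible set is nowhere dense. -/
lemma inter_nonempty_of_isConstructible {X : Type*} [TopologicalSpace X] {E A : Set X}
    (hE : IsConstructible E) (hne : E.Nonempty) (hAE : A ⊆ closure E) (hEA : E ⊆ closure A) :
    (A ∩ E).Nonempty := by
  let ι : closure E → X := Subtype.val
  have dense_preimage {B : Set X} (hBE : B ⊆ closure E) (hEB : E ⊆ closure B) :
      Dense (ι ⁻¹' B) := fun z ↦ by
    rw [IsInducing.subtypeVal.closure_eq_preimage_closure_image, Subtype.image_preimage_coe,
      inter_eq_right.mpr hBE]
    exact closure_minimal hEB isClosed_closure z.2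
  have dense_interior : Dense (interior (ι ⁻¹' E)) := by
    rw [← self_sdiff_frontier]
    exact (dense_preimage subset_closure subset_closure).inter_of_isOpen_right
      (interior_eq_empty_iff_dense_compl.mp <|
        interior_frontier_preimage_eq_empty continuous_subtype_val hE)
      isClosed_frontier.isOpen_compl
  obtain ⟨e, he⟩ := hne
  have : Nonempty (closure E) := ⟨e, subset_closure he⟩
  obtain ⟨z, hzE, hzA⟩ := (dense_preimage hAE hEA).inter_open_nonempty _ isOpen_interior
    dense_interior.nonempty
  exact ⟨z, hzA, interior_subset (s := ι ⁻¹' E) hzE⟩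

lemma exists_closure_image_Ici_eq {X ι : Type*} [TopologicalSpace X] [NoetherianSpace X]
    [Preorder ι] [Nonempty ι] (s : ι → X) :
    ∃ m, ∀ n ≥ m, closure (s '' Ici n) = closure (s '' Ici m) := by
  let T : ι → Closeds X := fun n ↦ ⟨closure (s '' Ici n), isClosed_closure⟩
  obtain ⟨_, ⟨m, rfl⟩, hmin⟩ := wellFounded_lt.has_min (range T) (range_nonempty T)
  refine ⟨m, fun n hn ↦ congrArg (fun Z : Closeds X ↦ (Z : Set X)) (?_ : T n = T m)⟩
  have hle : T n ≤ T m := closure_mono (image_mono (Ici_subset_Ici.mpr hn))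
  exact eq_of_le_of_not_lt hle (hmin _ ⟨n, rfl⟩)

variable {M P : Type*} [Semigroup M]

/-- The shearing map `(a, b) ↦ (a, a * b)` of the square of a semigroup `M`, transported to a set
`P` of pairs of elements of `M`. -/
def shear (φ : M × M ≃ P) (p : P) : P := φ ((φ.symm p).1, (φ.symm p).1 * (φ.symm p).2)

lemma shear_apply (φ : M × M ≃ P) (a b : M) : shear φ (φ (a, b)) = φ (a, a * b) := by
  rw [shear, Equiv.symm_apply_apply]

variable [TopologicalSpace P] {φ : M × M ≃ P} {x : M} {m : ℕ+}

/-- The closure of the set of pairs of powers of `x` with exponents at least `m`. -/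
def closurePowerPairs (φ : M × M ≃ P) (x : M) (m : ℕ+) : Set P :=
  closure {p | ∃ a ≥ m, ∃ b ≥ m, φ (semigroupPow x a, semigroupPow x b) = p}

lemma pair_semigroupPow_mem_closurePowerPairs {a b : ℕ+} (ha : m ≤ a) (hb : m ≤ b) :
    φ (semigroupPow x a, semigroupPow x b) ∈ closurePowerPairs φ x m :=
  subset_closure ⟨a, ha, b, hb, rfl⟩

variable [TopologicalSpace M]

/-- The properties of the Zariski topologies on the set `M` of points of a semigroup variety and on
the set of points of its square which are needed to find idempotents in `M`. Since the topology of
the square is not the product topology, the square is a separate space `P`, identified with `M × M`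
by `φ`. -/
structure IsZariskiSquare (φ : M × M ≃ P) : Prop where
  continuous_prodMk_right (a : M) : Continuous fun b ↦ φ (a, b)
  continuous_prodMk_left (b : M) : Continuous fun a ↦ φ (a, b)
  continuous_snd : Continuous fun p ↦ (φ.symm p).2
  continuous_shear : Continuous (shear φ)
  isConstructible_image_shear {Z : Set P} (hZ : IsClosed Z) : IsConstructible (shear φ '' Z)
  isClosed_centralizer (a : M) : IsClosed {w : M | a * w = w * a}
  isClosed_fixedPoints (a : M) : IsClosed {w : M | w * a = w}

/-- The closure of the set of powers of `x` with exponents at least `m`. -/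
def closurePowers (x : M) (m : ℕ+) : Set M := closure (semigroupPow x '' Ici m)

lemma semigroupPow_mem_closurePowers {n : ℕ+} (hn : m ≤ n) :
    semigroupPow x n ∈ closurePowers x m :=
  subset_closure ⟨n, hn, rfl⟩

lemma semigroupPow_mem_closure_image_Ici
    (hm : ∀ n ≥ m, closurePowers x n = closurePowers x m) {n : ℕ+} (hn : m ≤ n) (c : ℕ+) :
    semigroupPow x n ∈ closure (semigroupPow x '' Ici (c + m)) := by
  have := semigroupPow_mem_closurePowers (x := x) hn
  rwa [← hm (c + m) (PNat.lt_add_left m c).le] at this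

namespace IsZariskiSquare

lemma snd_mem_closurePowers (hφ : IsZariskiSquare φ) {p : P} (hp : p ∈ closurePowerPairs φ x m) :
    (φ.symm p).2 ∈ closurePowers x m := by
  refine map_mem_closure (f := fun p ↦ (φ.symm p).2) hφ.continuous_snd hp ?_
  rintro _ ⟨a, -, b, hb, rfl⟩
  exact ⟨b, hb, (congrArg Prod.snd (φ.symm_apply_apply (_, semigroupPow x b))).symm⟩

lemma commute_of_mem_closurePowers (hφ : IsZariskiSquare φ) {z : M}
    (hz : z ∈ closurePowers x m) : Commute x z := by
  refine closure_minimal ?_ (hφ.isClosed_centralizer x) hz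
  rintro _ ⟨n, -, rfl⟩
  exact commute_semigroupPow_right (Commute.refl x) n

lemma image_shear_subset (hφ : IsZariskiSquare φ) :
    shear φ '' closurePowerPairs φ x m ⊆ closurePowerPairs φ x m := by
  rintro _ ⟨p, hp, rfl⟩
  refine map_mem_closure hφ.continuous_shear hp ?_
  rintro _ ⟨a, ha, b, hb, rfl⟩
  exact ⟨a, ha, a + b, hb.trans (PNat.lt_add_left b a).le, by rw [shear_apply, semigroupPow_add]⟩

section Stable

variable (hm : ∀ n ≥ m, closurePowers x n = closurePowers x m)
include hm

lemma closurePowerPairs_subset_closure_lt (hφ : IsZariskiSquare φ) :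
    closurePowerPairs φ x m ⊆
      closure {p | ∃ b ≥ m, ∃ a > b, φ (semigroupPow x a, semigroupPow x b) = p} := by
  refine closure_minimal ?_ isClosed_closure
  rintro _ ⟨a, ha, b, hb, rfl⟩
  refine map_mem_closure (f := fun w ↦ φ (w, semigroupPow x b))
    (hφ.continuous_prodMk_left _) (semigroupPow_mem_closure_image_Ici hm ha b) ?_
  rintro _ ⟨n, hn, rfl⟩
  exact ⟨b, hb, n, (PNat.lt_add_right b m).trans_le hn, rfl⟩

lemma closurePowerPairs_subset_closure_image_shear (hφ : IsZariskiSquare φ) :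
    closurePowerPairs φ x m ⊆ closure (shear φ '' closurePowerPairs φ x m) := by
  refine closure_minimal ?_ isClosed_closure
  rintro _ ⟨a, ha, b, hb, rfl⟩
  refine map_mem_closure (f := fun w ↦ φ (semigroupPow x a, w))
    (hφ.continuous_prodMk_right _) (semigroupPow_mem_closure_image_Ici hm hb a) ?_
  rintro _ ⟨n, hn, rfl⟩
  obtain ⟨d, rfl⟩ : ∃ d, n = a + d :=
    ⟨n - a, (PNat.add_sub_of_lt ((PNat.lt_add_right a m).trans_le hn)).symm⟩
  refine ⟨_, pair_semigroupPow_mem_closurePowerPairs ha (le_of_add_le_add_left hn), ?_⟩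
  rw [shear_apply, semigroupPow_add]

/- The pairs `(x ^ a, x ^ b)` with `a > b ≥ m` are dense in the closure of a constructible set, the
image under the shearing map of the closure of all power pairs, and hence one of them belongs to
this image. -/
lemma exists_semigroupPow_mul_eq (hφ : IsZariskiSquare φ) :
    ∃ b ≥ m, ∃ c, ∃ z ∈ closurePowers x m,
      semigroupPow x (b + c) * z = semigroupPow x b := by
  obtain ⟨_, ⟨b, hb, a, hab, rfl⟩, p, hp, hpab⟩ :=
    inter_nonempty_of_isConstructible (hφ.isConstructible_image_shear isClosed_closure)
      ⟨_, _, pair_semigroupPow_mem_closurePowerPairs (φ := φ) (x := x) le_rfl le_rfl, rfl⟩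
      (Subset.trans (by
        rintro _ ⟨b, hb, a, hab, rfl⟩
        exact pair_semigroupPow_mem_closurePowerPairs (hb.trans hab.le) hb)
        (closurePowerPairs_subset_closure_image_shear hm hφ))
      (hφ.image_shear_subset.trans (closurePowerPairs_subset_closure_lt hm hφ))
  have hpab : ((φ.symm p).1, (φ.symm p).1 * (φ.symm p).2) = (semigroupPow x a, semigroupPow x b) :=
    φ.injective hpab
  rw [Prod.mk.injEq] at hpab
  refine ⟨b, hb, a - b, _, hφ.snd_mem_closurePowers hp, ?_⟩
  rw [PNat.add_sub_of_lt hab, ← hpab.1, hpab.2]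

lemma mul_eq_self_of_mem_closurePowers (hφ : IsZariskiSquare φ) {b : ℕ+} (hb : m ≤ b) {f : M}
    (hf : semigroupPow x b * f = semigroupPow x b) {w : M} (hw : w ∈ closurePowers x m) :
    w * f = w := by
  rw [← hm (b + 1) (hb.trans (PNat.lt_add_right b 1).le)] at hw
  refine closure_minimal ?_ (hφ.isClosed_fixedPoints f) hw
  rintro _ ⟨n, hn, rfl⟩
  obtain ⟨d, rfl⟩ : ∃ d, n = d + b :=
    ⟨n - b, (PNat.sub_add_of_lt ((PNat.lt_add_right b 1).trans_le hn)).symm⟩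
  rw [mem_ofPred_eq, semigroupPow_add, mul_assoc, hf]

end Stable

theorem exists_isGroupInverse [NoetherianSpace M] (hφ : IsZariskiSquare φ) (x : M) :
    ∃ (n : ℕ+) (y : M), IsGroupInverse (semigroupPow x n) y := by
  obtain ⟨m, hm⟩ := exists_closure_image_Ici_eq (semigroupPow x)
  obtain ⟨b, hb, c, z, hz, hxz⟩ := exists_semigroupPow_mul_eq hm hφ
  let q := semigroupPow x c
  have commute : Commute q z :=
    (commute_semigroupPow_right (hφ.commute_of_mem_closurePowers hz).symm c).symm
  have mul_eq_self {w : M} (hw : w ∈ closurePowers x m) : w * (q * z) = w :=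
    mul_eq_self_of_mem_closurePowers hm hφ hb
      (by rw [← mul_assoc, ← semigroupPow_add, hxz]) hw
  refine ⟨c * b, semigroupPow z b, ?_⟩
  rw [semigroupPow_mul]
  refine .semigroupPow_of_commute commute (mul_eq_self hz) ?_
  rw [← semigroupPow_mul]
  exact mul_eq_self (semigroupPow_mem_closurePowers (hb.trans (le_mul_of_one_le_left' one_le)))

end IsZariskiSquare

end Topology

namespace SemigroupObj

variable {C : Type w} [Category.{v} C] [CartesianMonoidalCategory C]

lemma comp_mul {T T' S : C} [SemigroupObj S] (f : T' ⟶ T) (a b : T ⟶ S) :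
    f ≫ (a * b) = f ≫ a * f ≫ b := by
  change f ≫ lift a b ≫ mul = lift (f ≫ a) (f ≫ b) ≫ mul
  rw [comp_lift_assoc]

/-- Precomposition with a morphism `f`, as a homomorphism between semigroups of points. -/
def compHom {T T' : C} (f : T' ⟶ T) (S : C) [SemigroupObj S] : (T ⟶ S) →ₙ* (T' ⟶ S) where
  toFun a := f ≫ a
  map_mul' := comp_mul f

lemma comp_semigroupPow {T T' S : C} [SemigroupObj S] (f : T' ⟶ T) (a : T ⟶ S) (n : ℕ+) :
    f ≫ semigroupPow a n = semigroupPow (f ≫ a) n :=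
  map_semigroupPow (compHom f S) a n

/-- By Yoneda, semigroup structures on the sets of `T`-points of `X`, functorial in `T`, make `X` a
semigroup object. -/
abbrev ofSemigroupHom {X : C} [∀ T : C, Semigroup (T ⟶ X)]
    (h : ∀ {T T' : C} (f : T' ⟶ T) (a b : T ⟶ X), f ≫ (a * b) = f ≫ a * f ≫ b) :
    SemigroupObj X where
  mul := fst X X * snd X X
  mul_assoc := by
    simp only [h, whiskerRight_fst, whiskerRight_snd, whiskerLeft_fst, whiskerLeft_snd,
      associator_hom_fst, associator_hom_snd_fst, associator_hom_snd_snd, _root_.mul_assoc]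

variable {D : Type*} [Category* D] {F : D ⥤ C} {G : C ⥤ D}

lemma comp_homEquiv_mul (adj : F ⊣ G) (S : C) [SemigroupObj S] {T T' : D} (f : T' ⟶ T)
    (a b : T ⟶ G.obj S) :
    f ≫ adj.homEquiv _ _ ((adj.homEquiv _ _).symm a * (adj.homEquiv _ _).symm b) =
      adj.homEquiv _ _ ((adj.homEquiv _ _).symm (f ≫ a) * (adj.homEquiv _ _).symm (f ≫ b)) := by
  rw [← adj.homEquiv_naturality_left, comp_mul, adj.homEquiv_naturality_left_symm,
    adj.homEquiv_naturality_left_symm]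

variable [CartesianMonoidalCategory D]

/-- A right adjoint functor maps semigroup objects to semigroup objects. -/
abbrev ofAdjunction (adj : F ⊣ G) (S : C) [SemigroupObj S] : SemigroupObj (G.obj S) :=
  letI (T : D) : Semigroup (T ⟶ G.obj S) := (adj.homEquiv T S).symm.semigroup
  ofSemigroupHom (comp_homEquiv_mul adj S)

lemma ofAdjunction_homEquiv_mul (adj : F ⊣ G) (S : C) [SemigroupObj S] {T : D}
    (a b : F.obj T ⟶ S) :
    letI := ofAdjunction adj S
    adj.homEquiv _ _ (a * b) = adj.homEquiv _ _ a * adj.homEquiv _ _ b := by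
  refine Eq.trans ?_ (comp_homEquiv_mul adj S (lift _ _) _ _).symm
  rw [lift_fst, lift_snd, Equiv.symm_apply_apply, Equiv.symm_apply_apply]

end SemigroupObj

lemma comp_toUnit_comp {C : Type w} [Category.{v} C] [CartesianMonoidalCategory C] {X Y : C}
    (p : 𝟙_ C ⟶ X) (a : 𝟙_ C ⟶ Y) : p ≫ toUnit X ≫ a = a := by
  rw [comp_toUnit_assoc, toUnit_unit, Category.id_comp]

lemma shear_homEquivToProd_symm {C : Type w} [Category.{v} C] [CartesianMonoidalCategory C]
    (T S : C) [SemigroupObj S] :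
    shear (homEquivToProd (X := S) (Y := S) (Z := T)).symm =
      fun p ↦ p ≫ lift (fst S S) (fst S S * snd S S) := by
  funext p
  rw [comp_lift, SemigroupObj.comp_mul]
  rfl

namespace IsGroupInverse

variable {C : Type w} [Category.{v} C] [CartesianMonoidalCategory C] {T T' S : C} [SemigroupObj S]

lemma comp (f : T' ⟶ T) {p y : T ⟶ S} (h : IsGroupInverse p y) :
    IsGroupInverse (f ≫ p) (f ≫ y) :=
  h.map (SemigroupObj.compHom f S)

lemma of_comp {f : T' ⟶ T} (hf : ∀ a b : T ⟶ S, f ≫ a = f ≫ b → a = b) {p y : T ⟶ S}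
    (h : IsGroupInverse (f ≫ p) (f ≫ y)) : IsGroupInverse p y :=
  IsGroupInverse.of_map (φ := SemigroupObj.compHom f S) hf h

/- By uniqueness, the two pullbacks of the group inverse to the source of the coequalizer diagram
agree. -/
lemma exists_of_isRegularEpi (π : T' ⟶ T) [IsRegularEpi π] {p : T ⟶ S} {y : T' ⟶ S}
    (h : IsGroupInverse (π ≫ p) y) : ∃ z : T ⟶ S, IsGroupInverse p z := by
  have pullback_eq : IsRegularEpi.left π ≫ y = IsRegularEpi.right π ≫ y := by
    have hleft := h.comp (IsRegularEpi.left π)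
    rw [reassoc_of% IsRegularEpi.w π] at hleft
    exact hleft.unique (h.comp (IsRegularEpi.right π))
  let z := IsRegularEpi.desc π y pullback_eq
  refine ⟨z, of_comp (f := π) (fun a b ↦ (cancel_epi π).mp) ?_⟩
  rwa [IsRegularEpi.fac]

end IsGroupInverse

lemma exists_comp_eq_of_range_subset {T V X : Scheme.{u}} [IsReduced T] (i : V ⟶ X) [IsImmersion i]
    (f : T ⟶ X) (h : Set.range f ⊆ Set.range i) : ∃ g : T ⟶ V, g ≫ i = f := by
  let π := Limits.pullback.snd i f
  have : Surjective π := ⟨Set.range_eq_univ.mp <| by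
    rw [Scheme.Pullback.range_snd, Set.preimage_eq_univ_iff.mpr h]⟩
  have : IsClosedImmersion π := .of_isPreimmersion _ <| by
    rw [Set.range_eq_univ.mpr π.surjective]; exact isClosed_univ
  have : IsIso π := isIso_of_isClosedImmersion_of_surjective π
  exact ⟨inv π ≫ Limits.pullback.fst i f, by
    rw [Category.assoc, Limits.pullback.condition, IsIso.inv_hom_id_assoc]⟩

section RatPoints

open TopologicalSpace Topology

variable {k : Type u} [Field k]

lemma isNoetherian_of_finiteType (X : Over (Spec (.of k))) [LocallyOfFiniteType X.hom]
    [QuasiCompact X.hom] : IsNoetherian X.left :=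
  { LocallyOfFiniteType.isLocallyNoetherian X.hom with
    toCompactSpace := QuasiCompact.compactSpace_of_compactSpace X.hom }

namespace RatPoints

/-- The point of the scheme `X` underlying a rational point. -/
noncomputable def pt {X : Over (Spec (.of k))} (p : RatPoints X) : X.left :=
  p.left (IsLocalRing.closedPoint k)

/-- The Zariski topology on the set of rational points, induced from the scheme. -/
@[reducible]
noncomputable def zariskiTopology (X : Over (Spec (.of k))) : TopologicalSpace (RatPoints X) :=
  .induced pt inferInstance

attribute [local instance] zariskiTopology

variable {X Y : Over (Spec (.of k))}

lemma continuous_comp (f : X ⟶ Y) : Continuous fun p : RatPoints X ↦ p ≫ f :=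
  continuous_induced_rng.mpr (f.left.continuous.comp continuous_induced_dom)

lemma exists_comp_eq {V : Over (Spec (.of k))} (i : V ⟶ X) [IsImmersion i.left] (p : RatPoints X)
    (hp : p.pt ∈ Set.range i.left) : ∃ q : RatPoints V, q ≫ i = p := by
  have : Subsingleton (𝟙_ (Over (Spec (.of k)))).left :=
    inferInstanceAs (Subsingleton (Spec (.of k)))
  have range_subset : Set.range p.left ⊆ Set.range i.left := by
    rintro _ ⟨a, rfl⟩
    rwa [Subsingleton.elim a (IsLocalRing.closedPoint k)]
  have : IsReduced (𝟙_ (Over (Spec (.of k)))).left := inferInstanceAs (IsReduced (Spec (.of k)))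
  obtain ⟨g, hg⟩ := exists_comp_eq_of_range_subset i.left p.left range_subset
  exact ⟨Over.homMk g (by rw [← Over.w i, reassoc_of% hg, Over.w p]), by ext1; exact hg⟩

lemma isClosed_comp_eq [IsSeparated Y.hom] (f g : X ⟶ Y) :
    IsClosed {p : RatPoints X | p ≫ f = p ≫ g} := by
  let ι := Limits.equalizer.ι f g
  have setOf_eq : {p : RatPoints X | p ≫ f = p ≫ g} = pt ⁻¹' Set.range ι.left := by
    ext p
    refine ⟨fun h ↦ ⟨pt (Limits.equalizer.lift p h), ?_⟩, fun h ↦ ?_⟩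
    · exact congrArg pt (Limits.equalizer.lift_ι p h)
    · obtain ⟨q, rfl⟩ := exists_comp_eq ι p h
      exact ((Category.assoc _ _ _).trans (congrArg (q ≫ ·) (Limits.equalizer.condition f g))).trans
        (Category.assoc _ _ _).symm
  rw [setOf_eq]
  exact ι.left.isClosedEmbedding.isClosed_range.preimage continuous_induced_dom

lemma noetherianSpace (X : Over (Spec (.of k))) [LocallyOfFiniteType X.hom] [QuasiCompact X.hom] :
    NoetherianSpace (RatPoints X) :=
  have := isNoetherian_of_finiteType X
  IsInducing.noetherianSpace (i := pt) ⟨rfl⟩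

variable [IsAlgClosed k] [LocallyOfFiniteType X.hom]

variable (X) in
lemma pt_injective : Function.Injective (pt (X := X)) := fun p q h ↦ by
  ext1
  exact ext_of_apply_closedPoint_eq X.hom (Over.w p) (Over.w q) h

lemma exists_pt_eq {x : X.left} (hx : IsClosed {x}) : ∃ p : RatPoints X, p.pt = x :=
  ⟨Over.homMk (pointOfClosedPoint X.hom x hx) (pointOfClosedPoint_comp X.hom x hx),
    pointOfClosedPoint_apply X.hom x hx _⟩

lemma isClosed_singleton_pt (p : RatPoints X) : IsClosed {p.pt} :=
  (pointEquivClosedPoint X.hom ⟨p.left, Over.w p⟩).2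

/- The fibres of `f` over closed points are of finite type over `k`, so that their closed points
are dense and rational. -/
lemma image_comp_preimage_pt [LocallyOfFiniteType Y.hom] (f : X ⟶ Y) {D : Set X.left}
    (hD : IsClosed D) :
    (fun p : RatPoints X ↦ p ≫ f) '' (pt ⁻¹' D) = pt ⁻¹' (f.left '' D) := by
  have : JacobsonSpace X.left := LocallyOfFiniteType.jacobsonSpace X.hom
  ext q
  constructor
  · rintro ⟨p, hp, rfl⟩
    exact ⟨pt p, hp, rfl⟩
  · rintro ⟨d, hd, hdq⟩
    let F : Set X.left := D ∩ f.left ⁻¹' {pt q}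
    have isClosed_fiber : IsClosed F :=
      hD.inter ((isClosed_singleton_pt q).preimage f.left.continuous)
    obtain ⟨z, ⟨hzD, hzq⟩, hz⟩ :=
      nonempty_inter_closedPoints (Z := F) ⟨d, hd, hdq⟩ isClosed_fiber.isLocallyClosed
    obtain ⟨p, rfl⟩ := exists_pt_eq hz
    exact ⟨p, hzD, pt_injective Y hzq⟩

lemma isConstructible_image_comp [QuasiCompact X.hom] [LocallyOfFiniteType Y.hom]
    [QuasiCompact Y.hom] (f : X ⟶ Y) {Z : Set (RatPoints X)} (hZ : IsClosed Z) :
    IsConstructible ((fun p ↦ p ≫ f) '' Z) := by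
  obtain ⟨D, hD, rfl⟩ := isClosed_induced_iff.mp hZ
  have := isNoetherian_of_finiteType X
  have := isNoetherian_of_finiteType Y
  have := noetherianSpace Y
  have : LocallyOfFiniteType (f.left ≫ Y.hom) := by rwa [Over.w f]
  have : LocallyOfFiniteType f.left := locallyOfFiniteType_of_comp f.left Y.hom
  have isConstructible : IsConstructible D := isConstructible_compl.mp <|
    (NoetherianSpace.isCompact Dᶜ).isConstructible hD.isOpen_compl
  rw [image_comp_preimage_pt f hD]
  exact (f.left.isConstructible_image isConstructible).preimage continuous_induced_dom
    fun _ _ _ _ _ _ ↦ NoetherianSpace.isCompact _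

variable (X) in
lemma isZariskiSquare [QuasiCompact X.hom] [IsSeparated X.hom] [SemigroupObj X] :
    IsZariskiSquare (homEquivToProd.symm : RatPoints X × RatPoints X ≃ RatPoints (X ⊗ X)) where
  continuous_prodMk_right a := by
    convert continuous_comp (lift (toUnit X ≫ a) (𝟙 X)) using 2 with p
    rw [comp_lift, comp_toUnit_comp, Category.comp_id]; rfl
  continuous_prodMk_left b := by
    convert continuous_comp (lift (𝟙 X) (toUnit X ≫ b)) using 2 with p
    rw [comp_lift, comp_toUnit_comp, Category.comp_id]; rfl
  continuous_snd := continuous_comp (snd X X)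
  continuous_shear := by
    rw [shear_homEquivToProd_symm]
    exact continuous_comp _
  isConstructible_image_shear hZ := by
    have : LocallyOfFiniteType (X ⊗ X).hom := by rw [Over.tensorObj_hom]; infer_instance
    have : QuasiCompact (X ⊗ X).hom := by rw [Over.tensorObj_hom]; infer_instance
    rw [shear_homEquivToProd_symm]
    exact isConstructible_image_comp _ hZ
  isClosed_centralizer a := by
    convert isClosed_comp_eq ((toUnit X ≫ a) * 𝟙 X) (𝟙 X * (toUnit X ≫ a)) using 4 with p
    · rw [SemigroupObj.comp_mul, comp_toUnit_comp, Category.comp_id]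
    · rw [SemigroupObj.comp_mul, comp_toUnit_comp, Category.comp_id]
  isClosed_fixedPoints a := by
    convert isClosed_comp_eq (𝟙 X * (toUnit X ≫ a)) (𝟙 X) using 4 with p
    · rw [SemigroupObj.comp_mul, comp_toUnit_comp, Category.comp_id]
    · rw [Category.comp_id]

theorem exists_isGroupInverse [QuasiCompact X.hom] [IsSeparated X.hom] [SemigroupObj X]
    (x : RatPoints X) : ∃ (n : ℕ+) (y : RatPoints X), IsGroupInverse (semigroupPow x n) y :=
  have := noetherianSpace X
  (isZariskiSquare X).exists_isGroupInverse x

end RatPoints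

end RatPoints

section BaseChange

lemma isRegularEpi_of_isRegularEpi_left {C : Type*} [Category* C] [Limits.HasPullbacks C] {B : C}
    {X Y : Over B} (f : X ⟶ Y) [IsRegularEpi f.left] : IsRegularEpi f := by
  have : Epi f := Over.epi_of_epi_left f
  refine .of_epi_of_exists fun Z g hg ↦ ?_
  obtain ⟨u, hu⟩ := IsRegularEpi.exists_of_isKernelPair f.left
    ((IsPullback.of_hasPullback f f).map (Over.forget B)) g.left (congrArg (·.left) hg)
  have comp_hom : u ≫ Z.hom = Y.hom := by
    rw [← cancel_epi f.left, reassoc_of% hu, Over.w g, Over.w f]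
  exact ⟨Over.homMk u comp_hom, by ext1; exact hu⟩

variable {B : Scheme.{u}} (S : Over B) [LocallyOfFiniteType S.hom] [QuasiCompact S.hom]
  [IsSeparated S.hom] [SemigroupObj S]

theorem exists_isGroupInverse_of_isAlgClosed {L : Type u} [Field L] [IsAlgClosed L]
    (f : Spec (.of L) ⟶ B) (x : Over.mk f ⟶ S) :
    ∃ (n : ℕ+) (y : Over.mk f ⟶ S), IsGroupInverse (semigroupPow x n) y := by
  let adj := Over.mapPullbackAdj f
  let X := (Over.pullback f).obj S
  let : SemigroupObj X := SemigroupObj.ofAdjunction adj S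
  have : LocallyOfFiniteType X.hom :=
    inferInstanceAs (LocallyOfFiniteType (Limits.pullback.snd S.hom f))
  have : QuasiCompact X.hom := inferInstanceAs (QuasiCompact (Limits.pullback.snd S.hom f))
  have : IsSeparated X.hom := inferInstanceAs (IsSeparated (Limits.pullback.snd S.hom f))
  let i : (Over.map f).obj (𝟙_ (Over (Spec (.of L)))) ≅ Over.mk f :=
    Over.isoMk (Iso.refl _) ((Category.id_comp f).trans (Category.id_comp f).symm)
  let toRatPoints : (Over.mk f ⟶ S) →ₙ* RatPoints X :=
    .comp ⟨adj.homEquiv _ _, SemigroupObj.ofAdjunction_homEquiv_mul adj S⟩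
      (SemigroupObj.compHom i.hom S)
  have bijective : Function.Bijective toRatPoints :=
    (adj.homEquiv _ _).bijective.comp (Iso.homFromEquiv i).symm.bijective
  obtain ⟨n, y, hy⟩ := RatPoints.exists_isGroupInverse (toRatPoints x)
  obtain ⟨y, rfl⟩ := bijective.surjective y
  rw [← map_semigroupPow] at hy
  exact ⟨n, y, hy.of_map bijective.injective⟩

theorem exists_isGroupInverse_of_field {K : Type u} [Field K] (f : Spec (.of K) ⟶ B)
    (x : Over.mk f ⟶ S) :
    ∃ (n : ℕ+) (y : Over.mk f ⟶ S), IsGroupInverse (semigroupPow x n) y := by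
  let π : Spec (.of (AlgebraicClosure K)) ⟶ Spec (.of K) :=
    Spec.map (CommRingCat.ofHom (algebraMap K (AlgebraicClosure K)))
  have : Flat π := by
    rw [Flat.SpecMap_iff]
    exact RingHom.flat_algebraMap_iff.mpr inferInstance
  have : Surjective π := ⟨fun _ ↦ ⟨IsLocalRing.closedPoint _, Subsingleton.elim _ _⟩⟩
  let π' : Over.mk (π ≫ f) ⟶ Over.mk f := Over.homMk π
  have : IsRegularEpi π'.left := isRegularEpi_of_flat_of_surjective_of_isAffine π
  have : IsRegularEpi π' := isRegularEpi_of_isRegularEpi_left π'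
  obtain ⟨n, y, hy⟩ := exists_isGroupInverse_of_isAlgClosed S (π ≫ f) (π' ≫ x)
  rw [← SemigroupObj.comp_semigroupPow] at hy
  exact ⟨n, IsGroupInverse.exists_of_isRegularEpi π' hy⟩

end BaseChange

section SpreadingOut

lemma isReduced_image {X Y : Scheme.{u}} (f : X ⟶ Y) [QuasiCompact f] [IsReduced X] :
    IsReduced f.image := by
  have isReduced_quotient (U : Y.affineOpens) : _root_.IsReduced (Γ(Y, U.1) ⧸ f.ker.ideal U) := by
    rw [f.ker_apply U]
    exact isReduced_of_injective _ (RingHom.kerLift_injective (f.app U.1).hom)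
  have (U : f.ker.subschemeCover.openCover.I₀) :
      IsReduced (f.ker.subschemeCover.openCover.X U) :=
    have := isReduced_quotient U
    inferInstanceAs (IsReduced (Spec (.of (Γ(Y, U.1) ⧸ f.ker.ideal U))))
  exact .of_openCover _ f.ker.subschemeCover.openCover

lemma irreducibleSpace_image {X Y : Scheme.{u}} (f : X ⟶ Y) [QuasiCompact f] [IrreducibleSpace X] :
    IrreducibleSpace f.image := by
  rw [irreducibleSpace_def, Set.top_eq_univ, ← f.toImage.denseRange.closure_range,
    ← Set.image_univ]
  exact ((IrreducibleSpace.isIrreducible_univ _).image _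
    f.toImage.continuous.continuousOn).closure

lemma exists_isClosedImmersion_range_eq_closure {X : Scheme.{u}} (η : X) :
    ∃ (Z : Scheme.{u}) (i : Z ⟶ X), IsIntegral Z ∧ IsClosedImmersion i ∧
      Set.range i = closure {η} := by
  let f := X.fromSpecResidueField η
  have := isReduced_image f
  have := irreducibleSpace_image f
  refine ⟨f.image, f.imageι, isIntegral_of_irreducibleSpace_of_isReduced _, inferInstance, ?_⟩
  rw [Scheme.IdealSheafData.range_subschemeι, Scheme.Hom.support_ker,
    Scheme.range_fromSpecResidueField]

lemma isDominant_fromSpecStalkOfMem_genericPoint {X : Scheme.{u}} [IrreducibleSpace X]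
    (U : X.Opens) (hU : genericPoint X ∈ U) :
    IsDominant (U.fromSpecStalkOfMem (genericPoint X) hU) := by
  let c := U.fromSpecStalkOfMem (genericPoint X) hU (IsLocalRing.closedPoint _)
  have ι_c : U.ι c = genericPoint X := by
    change (U.fromSpecStalkOfMem _ hU ≫ U.ι) (IsLocalRing.closedPoint _) = _
    rw [Scheme.Opens.fromSpecStalkOfMem_ι, Scheme.fromSpecStalk_closedPoint]
  refine ⟨dense_iff_inter_open.mpr fun W hW ⟨w, hw⟩ ↦ ⟨c, ?_, _, rfl⟩⟩
  have genericPoint_mem : genericPoint X ∈ U.ι '' W :=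
    ((genericPoint_spec X).mem_open_set_iff (U.ι.isOpenEmbedding.isOpenMap W hW)).mpr
      ⟨U.ι w, trivial, w, hw, rfl⟩
  rwa [← ι_c, U.ι.isOpenEmbedding.injective.mem_set_image] at genericPoint_mem

variable {B : Scheme.{u}} (S : Over B) [LocallyOfFiniteType S.hom] [QuasiCompact S.hom]
  [IsSeparated S.hom] [SemigroupObj S]

theorem exists_isGroupInverse_of_isIntegral (T : Over B) [IsIntegral T.left] (x : T ⟶ S) :
    ∃ (U : T.left.Opens) (n : ℕ+) (y : Over.mk (U.ι ≫ T.hom) ⟶ S), genericPoint T.left ∈ U ∧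
      IsGroupInverse (semigroupPow ((Over.homMk U.ι : Over.mk (U.ι ≫ T.hom) ⟶ T) ≫ x) n) y := by
  let η := genericPoint T.left
  let j : Over.mk (T.left.fromSpecStalk η ≫ T.hom) ⟶ T := Over.homMk (T.left.fromSpecStalk η)
  obtain ⟨n, y, hy⟩ := exists_isGroupInverse_of_field S (K := T.left.functionField)
    (T.left.fromSpecStalk η ≫ T.hom) (j ≫ x)
  obtain ⟨U, hU, f, hf, hfS⟩ := spread_out_of_isGermInjective' T.hom S.hom (x := η) y.left
    (Over.w y)
  let i : Over.mk (T.left.fromSpecStalk η ≫ T.hom) ⟶ Over.mk (U.ι ≫ T.hom) :=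
    Over.homMk (U.fromSpecStalkOfMem η hU) (Scheme.Opens.fromSpecStalkOfMem_ι_assoc U η hU T.hom)
  have i_comp_ι : i ≫ Over.homMk U.ι = j := by
    ext1
    exact Scheme.Opens.fromSpecStalkOfMem_ι U η hU
  have i_comp_f : i ≫ Over.homMk f hfS = y := by
    ext1
    exact hf.symm
  have cancel_i (a b : Over.mk (U.ι ≫ T.hom) ⟶ S) (h : i ≫ a = i ≫ b) : a = b := by
    ext1
    have := isDominant_fromSpecStalkOfMem_genericPoint U hU
    have : IsReduced (Over.mk (U.ι ≫ T.hom)).left := inferInstanceAs (IsReduced U.toScheme)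
    exact ext_of_isDominant_of_isSeparated S.hom ((Over.w a).trans (Over.w b).symm)
      (U.fromSpecStalkOfMem η hU) (congrArg (·.left) h)
  refine ⟨U, n, Over.homMk f hfS, hU, IsGroupInverse.of_comp cancel_i ?_⟩
  rwa [SemigroupObj.comp_semigroupPow, reassoc_of% i_comp_ι, i_comp_f]

end SpreadingOut

section Stratification

open TopologicalSpace Topology

lemma exists_isOpen_inter_eq_closure_singleton_inter {X : Type*} [TopologicalSpace X]
    [NoetherianSpace X] [QuasiSober X] {Z : Set X} (hZ : IsClosed Z) (hne : Z.Nonempty) :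
    ∃ (η : X) (O : Set X), IsOpen O ∧ η ∈ O ∧ Z ∩ O = closure {η} ∩ O := by
  have := hne.to_subtype
  have : QuasiSober Z := hZ.isClosedEmbedding_subtypeVal.quasiSober
  let C := irreducibleComponent (Classical.arbitrary Z)
  obtain ⟨η, hη : IsGenericPoint η C⟩ := QuasiSober.sober
    (isIrreducible_irreducibleComponent (x := Classical.arbitrary Z)) isClosed_irreducibleComponent
  obtain ⟨_, ⟨O, hO, rfl⟩, ⟨z, hz⟩, subset_C⟩ :=
    NoetherianSpace.exists_isOpen_nonempty_subset_irreducibleComponent C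
      (irreducibleComponent_mem_irreducibleComponents _)
  have mem_O : (η : X) ∈ O :=
    (hη.mem_open_set_iff (hO.preimage continuous_subtype_val)).mpr ⟨z, subset_C hz, hz⟩
  refine ⟨η, O, hO, mem_O, Set.Subset.antisymm (fun w hw ↦ ⟨?_, hw.2⟩)
    (Set.inter_subset_inter_left _ (closure_minimal (Set.singleton_subset_iff.mpr η.2) hZ))⟩
  have mem_closure : (⟨w, hw.1⟩ : Z) ∈ closure {η} := hη.def.symm ▸ subset_C hw.2
  rwa [closure_subtype, Set.image_singleton] at mem_closure

lemma exists_partition_of_forall_exists_isOpen {X : Type*} [TopologicalSpace X] [NoetherianSpace X]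
    {G : Set X → Prop} (h : ∀ Z, IsClosed Z → Z.Nonempty →
      ∃ O, IsOpen O ∧ (Z ∩ O).Nonempty ∧ G (Z ∩ O)) (Z : Closeds X) :
    ∃ (m : ℕ) (U : Fin m → Set X), Pairwise (fun i j ↦ Disjoint (U i) (U j)) ∧
      ⋃ j, U j = Z ∧ ∀ j, G (U j) := by
  induction Z using WellFoundedLT.induction with
  | ind Z ih =>
  obtain hZ | hZ := (Z : Set X).eq_empty_or_nonempty
  · exact ⟨0, Fin.elim0, fun j ↦ j.elim0, by rw [hZ, Set.iUnion_of_empty], fun j ↦ j.elim0⟩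
  obtain ⟨O, hO, ⟨z, hzZ, hzO⟩, hG⟩ := h Z Z.isClosed hZ
  let Z' : Closeds X := ⟨Z \ O, Z.isClosed.sdiff hO⟩
  have lt : Z' < Z := lt_of_le_of_ne (fun _ hw ↦ hw.1) fun h ↦ (h ▸ hzZ : z ∈ Z').2 hzO
  obtain ⟨m, U, disjoint, iUnion_eq, hU⟩ := ih Z' lt
  refine ⟨m + 1, Fin.cons ((Z : Set X) ∩ O) U, ?_, ?_, Fin.cases hG hU⟩
  · have disjoint_head (j : Fin m) : Disjoint ((Z : Set X) ∩ O) (U j) :=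
      Set.disjoint_left.mpr fun _ hw hwU ↦
        (iUnion_eq.subset (Set.mem_iUnion_of_mem j hwU) : _ ∈ (Z : Set X) \ O).2 hw.2
    exact pairwise_fin_succ_iff.mpr ⟨fun j ↦ (disjoint_head j).symm, disjoint_head, disjoint⟩
  · rw [← (finSuccEquiv m).symm.surjective.iUnion_comp, Set.iUnion_option]
    exact (congrArg _ iUnion_eq).trans (Set.inter_union_sdiff _ _)

variable {B : Scheme.{u}} {S : Over B} [SemigroupObj S]

/-- `A` carries a reduced subscheme of `S` on which the `n`-th power map has a group inverse: the
`n`-th power of the inclusion, as a point of `S` with values in that subscheme, has one. -/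
def HasGroupInverseOn (n : ℕ+) (A : Set S.left) : Prop :=
  ∃ (V : Over B) (i y : V ⟶ S), IsReduced V.left ∧ IsImmersion i.left ∧
    Set.range i.left = A ∧ IsGroupInverse (semigroupPow i n) y

namespace HasGroupInverseOn

variable {n : ℕ+} {A : Set S.left}

lemma isLocallyClosed (h : HasGroupInverseOn n A) : IsLocallyClosed A := by
  obtain ⟨V, i, y, -, _, rfl, -⟩ := h
  exact i.left.isLocallyClosed_range

lemma mul (h : HasGroupInverseOn n A) (m : ℕ+) : HasGroupInverseOn (n * m) A := by
  obtain ⟨V, i, y, hV, hi, hA, h⟩ := h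
  exact ⟨V, i, _, hV, hi, hA, semigroupPow_mul i n m ▸ h.semigroupPow m⟩

lemma inter_isOpen {O : Set S.left} (h : HasGroupInverseOn n A) (hO : IsOpen O) :
    HasGroupInverseOn n (A ∩ O) := by
  obtain ⟨V, i, y, _, _, rfl, h⟩ := h
  let W : V.left.Opens := i.left ⁻¹ᵁ ⟨O, hO⟩
  let j : Over.mk (W.ι ≫ V.hom) ⟶ V := Over.homMk W.ι
  refine ⟨_, j ≫ i, j ≫ y, inferInstanceAs (IsReduced W.toScheme),
    inferInstanceAs (IsImmersion (W.ι ≫ i.left)), ?_,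
    SemigroupObj.comp_semigroupPow j i n ▸ h.comp j⟩
  change Set.range (W.ι ≫ i.left) = _
  rw [Scheme.Hom.comp_base, TopCat.coe_comp, Set.range_comp, Scheme.Opens.range_ι]
  exact Set.image_preimage_eq_range_inter

variable [LocallyOfFiniteType S.hom] [QuasiCompact S.hom] [IsSeparated S.hom]

lemma exists_closure_singleton_inter (η : S.left) :
    ∃ O, IsOpen O ∧ η ∈ O ∧ ∃ n, HasGroupInverseOn n (closure {η} ∩ O) := by
  obtain ⟨Z, i, _, _, range_i⟩ := exists_isClosedImmersion_range_eq_closure η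
  have : IsIntegral (Over.mk (i ≫ S.hom)).left := ‹IsIntegral Z›
  obtain ⟨(U : Z.Opens), n, y, hU, hy⟩ :=
    exists_isGroupInverse_of_isIntegral S (Over.mk (i ≫ S.hom)) (Over.homMk i)
  obtain ⟨O, hO, preimage_O⟩ := i.isClosedEmbedding.isInducing.isOpen_iff.mp U.isOpen
  have inter_eq : closure {η} ∩ O = i '' U := by
    rw [← range_i, ← Set.image_preimage_eq_range_inter, preimage_O]
  have mem_O : η ∈ O := by
    have : i (genericPoint Z) ∈ closure {η} ∩ O := inter_eq ▸ Set.mem_image_of_mem i hU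
    obtain ⟨_, hηO, rfl⟩ := mem_closure_iff.mp this.1 O hO this.2
    exact hηO
  refine ⟨O, hO, mem_O, n, _, _, y, inferInstanceAs (IsReduced U.toScheme),
    inferInstanceAs (IsImmersion (U.ι ≫ i)), ?_, hy⟩
  change Set.range (U.ι ≫ i) = _
  rw [Scheme.Hom.comp_base, TopCat.coe_comp, Set.range_comp, Scheme.Opens.range_ι, inter_eq]

lemma exists_inter_isOpen [NoetherianSpace S.left] {Z : Set S.left} (hZ : IsClosed Z)
    (hne : Z.Nonempty) :
    ∃ O, IsOpen O ∧ (Z ∩ O).Nonempty ∧ ∃ n, HasGroupInverseOn n (Z ∩ O) := by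
  obtain ⟨η, O₁, hO₁, mem_O₁, inter_eq⟩ := exists_isOpen_inter_eq_closure_singleton_inter hZ hne
  obtain ⟨O₂, hO₂, mem_O₂, n, hn⟩ := exists_closure_singleton_inter η
  have inter_inter_eq : Z ∩ (O₁ ∩ O₂) = closure {η} ∩ O₂ ∩ O₁ := by
    rw [← Set.inter_assoc, inter_eq, Set.inter_right_comm]
  exact ⟨O₁ ∩ O₂, hO₁.inter hO₂,
    inter_inter_eq ▸ ⟨η, ⟨subset_closure (Set.mem_singleton η), mem_O₂⟩, mem_O₁⟩, n,
    inter_inter_eq ▸ hn.inter_isOpen hO₁⟩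

variable (S) in
theorem exists_partition [NoetherianSpace S.left] :
    ∃ (n : ℕ+) (m : ℕ) (U : Fin m → Set S.left), Pairwise (fun i j ↦ Disjoint (U i) (U j)) ∧
      ⋃ j, U j = Set.univ ∧ ∀ j, HasGroupInverseOn n (U j) := by
  obtain ⟨m, U, disjoint, iUnion_eq, hU⟩ := exists_partition_of_forall_exists_isOpen
    (G := fun A : Set S.left ↦ ∃ n, HasGroupInverseOn n A) (fun _ ↦ exists_inter_isOpen) ⊤
  choose n hn using hU
  refine ⟨∏ j, n j, m, U, disjoint, iUnion_eq, fun j ↦ ?_⟩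
  obtain ⟨c, hc⟩ := Finset.dvd_prod_of_mem n (Finset.mem_univ j)
  exact hc ▸ (hn j).mul c

section RatPoints

variable {k : Type u} [Field k] {S : Over (Spec (.of k))} [SemigroupObj S] {n : ℕ+}
  {A : Set S.left}

lemma exists_isGroupInverse (h : HasGroupInverseOn n A) {x : RatPoints S} (hx : x.pt ∈ A) :
    ∃ y, IsGroupInverse (semigroupPow x n) y := by
  obtain ⟨V, i, y, _, _, rfl, h⟩ := h
  obtain ⟨q, rfl⟩ := RatPoints.exists_comp_eq i x hx
  exact ⟨q ≫ y, SemigroupObj.comp_semigroupPow q i n ▸ h.comp q⟩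

lemma isMorphismOn (h : HasGroupInverseOn n A) {e : RatPoints S → RatPoints S}
    (he : ∀ x, IsAttachedIdempotent x (e x)) : IsMorphismOn A e := by
  obtain ⟨V, i, y, hV, hi, hA, h⟩ := h
  refine ⟨V, i, semigroupPow i n * y, hV, hi, hA, fun p ↦ ?_⟩
  have attached := h.comp p
  rw [SemigroupObj.comp_semigroupPow] at attached
  rw [SemigroupObj.comp_mul, SemigroupObj.comp_semigroupPow,
    attached.isAttachedIdempotent.unique (he _)]

end RatPoints

end HasGroupInverseOn

end Stratification

theorem corollary1_general {k : Type u} [Field k]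
    (S : Over (Spec (.of k))) [LocallyOfFiniteType S.hom] [QuasiCompact S.hom]
    [IsSeparated S.hom] [SemigroupObj S] :
    ∃ e : RatPoints S → RatPoints S,
      (∀ x, IsAttachedIdempotent x (e x) ∧ ∀ f, IsAttachedIdempotent x f → f = e x) ∧
      (∃ n : ℕ+, ∀ x, semigroupPow x n ∈ cornerUnits (e x)) ∧
      ∃ (m : ℕ) (U : Fin m → Set S.left),
        (∀ j, IsLocallyClosed (U j)) ∧ (∀ i j, i ≠ j → Disjoint (U i) (U j)) ∧
        (⋃ j, U j) = Set.univ ∧ ∀ j, IsMorphismOn (U j) e := by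
  have := isNoetherian_of_finiteType S
  obtain ⟨n, m, U, disjoint, iUnion_eq, hU⟩ := HasGroupInverseOn.exists_partition S
  have exists_isGroupInverse (x : RatPoints S) : ∃ y, IsGroupInverse (semigroupPow x n) y :=
    have ⟨j, hj⟩ := Set.mem_iUnion.mp (iUnion_eq ▸ Set.mem_univ x.pt)
    (hU j).exists_isGroupInverse hj
  choose y hy using exists_isGroupInverse
  have attached (x : RatPoints S) : IsAttachedIdempotent x (semigroupPow x n * y x) :=
    (hy x).isAttachedIdempotent
  exact ⟨fun x ↦ semigroupPow x n * y x, fun x ↦ ⟨attached x, fun f hf ↦ hf.unique (attached x)⟩,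
    ⟨n, fun x ↦ (hy x).mem_cornerUnits⟩, m, U, fun j ↦ (hU j).isLocallyClosed,
    fun _ _ hij ↦ disjoint hij, iUnion_eq, fun j ↦ (hU j).isMorphismOn attached⟩

theorem corollary1 {k : Type u} [Field k] [IsAlgClosed k]
    (S : Over (Spec (.of k))) [LocallyOfFiniteType S.hom] [QuasiCompact S.hom]
    [IsSeparated S.hom] [IsReduced S.left] [SemigroupObj S] :
    ∃ e : RatPoints S → RatPoints S,
      (∀ x, IsAttachedIdempotent x (e x) ∧ ∀ f, IsAttachedIdempotent x f → f = e x) ∧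
      (∃ n : ℕ+, ∀ x, semigroupPow x n ∈ cornerUnits (e x)) ∧
      ∃ (m : ℕ) (U : Fin m → Set S.left),
        (∀ j, IsLocallyClosed (U j)) ∧ (∀ i j, i ≠ j → Disjoint (U i) (U j)) ∧
        (⋃ j, U j) = Set.univ ∧ ∀ j, IsMorphismOn (U j) e :=
  corollary1_general S
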